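/- Let $\Omega\subset\mathbb R^3$ be a bounded Lipschitz domain and $0<T<\infty$. Let $\varepsilon,\sigma,\mu\in L^\infty(\Omega;\mathbb R^{3\times3})$ be symmetric a.e. in $\Omega$, and suppose that there are constants $\varepsilon_0,\mu_0>0$ such that for a.e. $x\in\Omega$ and all $\xi\in\mathbb R^3$ $$\xi^\top\varepsilon(x)\xi\ge\varepsilon_0|\xi|^2,\qquad \xi^\top\mu(x)\xi\ge\mu_0|\xi|^2,\qquad \xi^\top\sigma(x)\xi\ge0 .$$ Let $f\in L^2(0,T;L^2(\Omega)^3)$ and $E_0,B_0\in L^2(\Omega)^3$. Write $(\cdot,\cdot)$ for the scalar product of $L^2(\Omega)^3$. Let $H(\operatorname{curl};\Omega)$ be the space of $v\in L^2(\Omega)^3$ with distributional $\operatorname{curl}v\in L^2(\Omega)^3$, with the graph norm, and let $H_0(\operatorname{curl};\Omega)$ be its subspace of fields with zero tangential trace on $\partial\Omega$. Let $L^2(\Omega)^3$ be embedded in the duals $H_0(\operatorname{curl};\Omega)^*$ and $H(\operatorname{curl};\Omega)^*$ by $u\mapsto(u,\cdot)$. A pair $(E,B)$ is called a weak solution with data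 $f,E_0,B_0$ if the following hold. * $E,B\in L^\infty(0,T;L^2(\Omega)^3)$, $\varepsilon E\in H^1(0,T;H_0(\operatorname{curl};\Omega)^*)$ and $B\in H^1(0,T;H(\operatorname{curl};\Omega)^*)$; the functional $\varepsilon\,\partial_tE$ is understood as the weak time derivative $\partial_t(\varepsilon E)$ in $L^2(0,T;H_0(\operatorname{curl};\Omega)^*)$. * For a.e. $t\in(0,T)$, $$\langle\varepsilon\,\partial_tE,\psi\rangle+(\sigma E,\psi)-(\mu^{-1}B,\operatorname{curl}\psi)=(f,\psi)\qquad\forall\,\psi\in H_0(\operatorname{curl};\Omega),$$ $$\langle\partial_tB,\phi\rangle+(E,\operatorname{curl}\phi)=0\qquad\forall\,\phi\in H(\operatorname{curl};\Omega).$$ * $E(0)=E_0$ and $B(0)=B_0$, in the sense that the representatives of $\varepsilon E$ in $C([0,T];H_0(\operatorname{curl};\Omega)^*)$ and of $B$ in $C([0,T];H(\operatorname{curl};\Omega)^*)$ take the values $\varepsilon E_0$ and $B_0$ at $t=0$. * If $\operatorname{div}B_0=0$ in the sense of distributions in $\Omega$, then $\operatorname{div}B(t)=0$ in $\Omega$ for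 a.e. $t\in(0,T)$, i.e. $B\in L^\infty(0,T;H(\operatorname{div}^0;\Omega))$. If $(E_1,B_1)$ and $(E_2,B_2)$ are weak solutions with the same data $f,E_0,B_0$, then $E_1(t)=E_2(t)$ and $B_1(t)=B_2(t)$ in $L^2(\Omega)^3$ for a.e. $t\in(0,T)$. -/

import Mathlib

open MeasureTheory Set Topology
open scoped ContDiff NNReal

noncomputable section

namespace Maxwell

/-- Three-dimensional Euclidean space. -/
abbrev R3 : Type := EuclideanSpace ℝ (Fin 3)

/-! ### Domains -/

/-- A bounded Lipschitz domain in `ℝ³`: a bounded, connected (in particular non-empty) open set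
which, near each of its boundary points and after a rigid rotation of the coordinates, is the
region strictly above the graph of a Lipschitz function of two variables. -/
structure IsBoundedLipschitzDomain (Ω : Set R3) : Prop where
  isOpen : IsOpen Ω
  isConnected : IsConnected Ω
  isBounded : Bornology.IsBounded Ω
  lipschitz_boundary : ∀ x ∈ frontier Ω,
    ∃ (U : Set R3) (L : R3 ≃ₗᵢ[ℝ] R3) (g : EuclideanSpace ℝ (Fin 2) → ℝ) (K : ℝ≥0),
      U ∈ 𝓝 x ∧ LipschitzWith K g ∧ ∀ y ∈ U, (y ∈ Ω ↔ g (!₂[L y 0, L y 1]) < L y 2)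

/-! ### Test functions and classical differential operators -/

/-- `φ ∈ C_c^∞(U; F)`, where functions on `U` are extended by zero to the whole space. -/
def IsTestFunction {X F : Type*} [NormedAddCommGroup X] [NormedSpace ℝ X]
    [NormedAddCommGroup F] [NormedSpace ℝ F] (U : Set X) (φ : X → F) : Prop :=
  ContDiff ℝ ∞ φ ∧ HasCompactSupport φ ∧ tsupport φ ⊆ U

/-- The partial derivative `∂ⱼ φᵢ (x)` of a vector field. -/
def partialDeriv (φ : R3 → R3) (j i : Fin 3) (x : R3) : ℝ :=
  fderiv ℝ φ x (EuclideanSpace.single j 1) i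

/-- The classical curl of a differentiable vector field. -/
def curl (φ : R3 → R3) (x : R3) : R3 :=
  !₂[partialDeriv φ 1 2 x - partialDeriv φ 2 1 x,
     partialDeriv φ 2 0 x - partialDeriv φ 0 2 x,
     partialDeriv φ 0 1 x - partialDeriv φ 1 0 x]

/-! ### The spaces `L²(Ω)³`, `H(curl; Ω)`, `H₀(curl; Ω)`, `H(div⁰; Ω)` -/

/-- `L²(Ω)³`. -/
abbrev L2 (Ω : Set R3) : Type := Lp R3 2 (volume.restrict Ω)

/-- A continuous compactly supported field is square integrable on `Ω`. -/
theorem memLp_of_continuous (Ω : Set R3) {φ : R3 → R3} (h : Continuous φ)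
    (hc : HasCompactSupport φ) : MemLp φ 2 (volume.restrict Ω) :=
  (h.memLp_of_hasCompactSupport hc).restrict Ω

theorem continuous_curl {φ : R3 → R3} (h : ContDiff ℝ ∞ φ) : Continuous (curl φ) := by
  have hf : Continuous (fderiv ℝ φ) := h.continuous_fderiv (by simp)
  have hp : ∀ j i, Continuous (partialDeriv φ j i) := by
    intro j i
    unfold partialDeriv
    fun_prop
  unfold curl
  refine (PiLp.continuous_toLp 2 _).comp (continuous_pi fun i => ?_)
  fin_cases i <;> simp <;> exact (hp _ _).sub (hp _ _)

theorem hasCompactSupport_curl {φ : R3 → R3} (h : HasCompactSupport φ) :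
    HasCompactSupport (curl φ) := by
  refine (h.fderiv (𝕜 := ℝ)).mono fun x hx => ?_
  contrapose! hx
  have h0 : fderiv ℝ φ x = 0 := by simpa using hx
  have : curl φ x = 0 := by
    ext i
    fin_cases i <;> simp [curl, partialDeriv, h0]
  simpa using this

/-- `(curl v, φ) - (v, curl φ)` for a pair `p = (v, curl v)` and a smooth field `φ`. -/
def greenDefect (Ω : Set R3) (p : WithLp 2 (L2 Ω × L2 Ω)) (φ : R3 → R3) : ℝ :=
  (∫ x in Ω, inner ℝ (p.snd x) (φ x)) - ∫ x in Ω, inner ℝ (p.fst x) (curl φ x)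

/-- Both integrals are `L²(Ω)³` inner products. -/
theorem greenDefect_eq (Ω : Set R3) (p : WithLp 2 (L2 Ω × L2 Ω)) {U : Set R3} {φ : R3 → R3}
    (h : IsTestFunction U φ) :
    greenDefect Ω p φ
      = inner ℝ p.snd ((memLp_of_continuous Ω h.1.continuous h.2.1).toLp φ)
        - inner ℝ p.fst ((memLp_of_continuous Ω (continuous_curl h.1)
            (hasCompactSupport_curl h.2.1)).toLp (curl φ)) := by
  rw [L2.inner_def, L2.inner_def, greenDefect]
  congr 1
  · refine integral_congr_ae ?_
    filter_upwards [(memLp_of_continuous Ω h.1.continuous h.2.1).coeFn_toLp] with x hx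
    rw [hx]
  · refine integral_congr_ae ?_
    filter_upwards [(memLp_of_continuous Ω (continuous_curl h.1)
      (hasCompactSupport_curl h.2.1)).coeFn_toLp] with x hx
    rw [hx]

/-- The pairs `(v, w)` whose Green defect vanishes for all test fields in `C_c^∞(U)³`. -/
def greenSpace (Ω U : Set R3) : Submodule ℝ (WithLp 2 (L2 Ω × L2 Ω)) where
  carrier := {p | ∀ φ : R3 → R3, IsTestFunction U φ → greenDefect Ω p φ = 0}
  zero_mem' := fun φ h => by simp [greenDefect_eq Ω _ h]
  add_mem' := fun {p q} hp hq φ h => by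
    have h1 := hp φ h
    have h2 := hq φ h
    rw [greenDefect_eq Ω _ h] at h1 h2 ⊢
    rw [WithLp.add_fst, WithLp.add_snd, inner_add_left, inner_add_left]
    linarith
  smul_mem' := fun c p hp φ h => by
    have h1 := hp φ h
    rw [greenDefect_eq Ω _ h] at h1 ⊢
    rw [WithLp.smul_fst, WithLp.smul_snd, real_inner_smul_left, real_inner_smul_left,
      ← mul_sub, h1, mul_zero]

/-- `H(curl; Ω)`. An element `v` is represented by the pair `(v, curl v)`: `p.fst = v` is in
`L²(Ω)³` and `p.snd` is its distributional curl, again in `L²(Ω)³` (it is determined by `v`).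
The norm is the graph norm `(‖v‖² + ‖curl v‖²)^{1/2}`. -/
def Hcurl (Ω : Set R3) : Submodule ℝ (WithLp 2 (L2 Ω × L2 Ω)) := greenSpace Ω Ω

/-- `H₀(curl; Ω)`: the `v ∈ H(curl; Ω)` with zero tangential trace. The tangential trace of
`v ∈ H(curl; Ω)` on the boundary of a bounded Lipschitz domain is the functional that Green's
formula defines, `φ ↦ (curl v, φ) - (v, curl φ)`; by density it vanishes as soon as it does for
all fields `φ` smooth up to the boundary, i.e. for the restrictions to `Ω` of `C_c^∞(ℝ³)³`. -/
def Hcurl0 (Ω : Set R3) : Submodule ℝ (WithLp 2 (L2 Ω × L2 Ω)) := Hcurl Ω ⊓ greenSpace Ω univ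

/-- `v ∈ H(div⁰; Ω)`: the distributional divergence of `v ∈ L²(Ω)³` vanishes. -/
def IsDivFree (Ω : Set R3) (v : L2 Ω) : Prop :=
  ∀ φ : R3 → ℝ, IsTestFunction Ω φ → ∫ x in Ω, fderiv ℝ φ x (v x) = 0

/-! ### Tensor fields -/

/-- A matrix acting on a vector of `ℝ³`. -/
def act (A : Matrix (Fin 3) (Fin 3) ℝ) (v : R3) : R3 := WithLp.toLp 2 (A.mulVec v.ofLp)

/-- A tensor field in `L^∞(Ω; ℝ^{3×3})`. -/
structure LinftyTensor (Ω : Set R3) where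
  /-- the values of the field -/
  toFun : R3 → Matrix (Fin 3) (Fin 3) ℝ
  memLp : ∀ i j, MemLp (fun x => toFun x i j) ⊤ (volume.restrict Ω)

/-- `A(x)` is symmetric for a.e. `x ∈ Ω`. -/
def LinftyTensor.IsSymmetric {Ω : Set R3} (A : LinftyTensor Ω) : Prop :=
  ∀ᵐ x ∂(volume.restrict Ω), (A.toFun x).IsSymm

/-- `ξᵀ A(x) ξ ≥ c |ξ|²` for all `ξ`, for a.e. `x ∈ Ω`. -/
def LinftyTensor.IsBoundedBelow {Ω : Set R3} (A : LinftyTensor Ω) (c : ℝ) : Prop :=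
  ∀ᵐ x ∂(volume.restrict Ω), ∀ ξ : R3, c * ‖ξ‖ ^ 2 ≤ inner ℝ ξ (act (A.toFun x) ξ)

theorem LinftyTensor.memLp_act {Ω : Set R3} (A : LinftyTensor Ω) (v : L2 Ω) :
    MemLp (fun x => act (A.toFun x) (v x)) 2 (volume.restrict Ω) := by
  refine MemLp.of_eval_piLp fun i => ?_
  have hv : ∀ j, MemLp (fun x => v x j) 2 (volume.restrict Ω) :=
    fun j => (Lp.memLp v).eval_piLp j
  have : (fun x => act (A.toFun x) (v x) i)
      = fun x => ∑ j, A.toFun x i j * v x j := by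
    funext x
    simp [act, Matrix.mulVec, dotProduct]
  rw [this]
  exact memLp_finsetSum _ fun j _ => (hv j).mul (A.memLp i j)

/-- The field `x ↦ A(x) v(x)` of `L²(Ω)³`. -/
def LinftyTensor.mul {Ω : Set R3} (A : LinftyTensor Ω) (v : L2 Ω) : L2 Ω :=
  (A.memLp_act v).toLp _

/-- `(A⁻¹ u, v)`, the scalar product in `L²(Ω)³`. -/
def LinftyTensor.invPairing {Ω : Set R3} (A : LinftyTensor Ω) (u v : L2 Ω) : ℝ :=
  ∫ x in Ω, inner ℝ (act (A.toFun x)⁻¹ (u x)) (v x)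

/-! ### Functions of time -/

/-- Lebesgue measure on `(0,T)`. -/
def timeMeasure (T : ℝ) : Measure ℝ := volume.restrict (Ioo 0 T)

/-- `u ∈ H¹(0,T;X)` with weak derivative `∂ₜ u = w`. -/
structure HasH1Deriv {X : Type*} [NormedAddCommGroup X] [NormedSpace ℝ X]
    (T : ℝ) (u w : ℝ → X) : Prop where
  memLp : MemLp u 2 (timeMeasure T)
  memLp_deriv : MemLp w 2 (timeMeasure T)
  integral_deriv : ∀ η : ℝ → ℝ, IsTestFunction (Ioo 0 T) η →
    ∫ t, deriv η t • u t ∂(timeMeasure T) = - ∫ t, η t • w t ∂(timeMeasure T)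

/-- `u(0) = a` for the continuous representative of `u` in `C([0,T];X)`. -/
def HasInitialValue {X : Type*} [NormedAddCommGroup X] (T : ℝ) (u : ℝ → X) (a : X) : Prop :=
  ∃ c : ℝ → X, ContinuousOn c (Icc 0 T) ∧ c =ᵐ[timeMeasure T] u ∧ c 0 = a

/-- The embedding of `L²(Ω)³` into the dual `V*` of `V = H(curl; Ω)` or `V = H₀(curl; Ω)`:
`u` is identified with the functional `ψ ↦ (u, ψ)`. -/
def toDual {Ω : Set R3} (V : Submodule ℝ (WithLp 2 (L2 Ω × L2 Ω))) (u : L2 Ω) :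
    StrongDual ℝ V :=
  (innerSL ℝ u).comp ((WithLp.fstL 2 ℝ (L2 Ω) (L2 Ω)).comp V.subtypeL)

/-! ### Weak solutions -/

/-- `(E, B)` is a weak solution of Maxwell's equations with data `f`, `E₀`, `B₀`.

For a coefficient `ε` that is only bounded and measurable, `ε ∂ₜE` is the derivative `∂ₜ(εE)` of
the function `t ↦ (εE(t), ·)` with values in `H₀(curl; Ω)*`, and the initial value of `E` is
the one of this function (`ε(x)` is invertible). -/
structure IsWeakSolution {Ω : Set R3} (T : ℝ) (ε σ μ : LinftyTensor Ω)
    (f : ℝ → L2 Ω) (E₀ B₀ : L2 Ω) (E B : ℝ → L2 Ω) : Prop where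
  E_bounded : MemLp E ⊤ (timeMeasure T)
  B_bounded : MemLp B ⊤ (timeMeasure T)
  /-- `E` is in `H¹(0,T; H₀(curl)*)`, in the sense that `ε ∂ₜE = ∂ₜ(εE) ∈ L²(0,T; H₀(curl)*)`,
  and Ampère's law holds -/
  ampere : ∃ D : ℝ → StrongDual ℝ (Hcurl0 Ω),
    HasH1Deriv T (fun t => toDual (Hcurl0 Ω) (ε.mul (E t))) D ∧
    ∀ᵐ t ∂(timeMeasure T), ∀ ψ : Hcurl0 Ω,
      D t ψ + inner ℝ (σ.mul (E t)) ψ.1.fst - μ.invPairing (B t) ψ.1.snd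
        = inner ℝ (f t) ψ.1.fst
  /-- `B ∈ H¹(0,T; H(curl)*)` and Faraday's law holds -/
  faraday : ∃ D : ℝ → StrongDual ℝ (Hcurl Ω),
    HasH1Deriv T (fun t => toDual (Hcurl Ω) (B t)) D ∧
    ∀ᵐ t ∂(timeMeasure T), ∀ φ : Hcurl Ω,
      D t φ + inner ℝ (E t) φ.1.snd = 0
  E_initial : HasInitialValue T (fun t => toDual (Hcurl0 Ω) (ε.mul (E t)))
    (toDual (Hcurl0 Ω) (ε.mul E₀))
  B_initial : HasInitialValue T (fun t => toDual (Hcurl Ω) (B t)) (toDual (Hcurl Ω) B₀)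
  /-- `B ∈ L^∞(0,T; H(div⁰; Ω))` if `div B₀ = 0` -/
  B_divFree : IsDivFree Ω B₀ → ∀ᵐ t ∂(timeMeasure T), IsDivFree Ω (B t)

end Maxwell

end

/-! Let e, b be the differences of the two solutions and U, V their time primitives, U(t) = ∫₀ᵗ e
and V(t) = ∫₀ᵗ b. One would like to test Ampère's law with e, but e need not have a curl in L². U
does: since the initial values cancel, the integrated Faraday law reads (b(t), φ) = -(U(t), curl φ)
for all φ in H(curl), which says that U(t) lies in H₀(curl) with curl U(t) = -b(t)
(`mem_Hcurl0_of_forall_inner_eq`).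

Testing the integrated Ampère law at time t with U(t) gives (εe, U) + (μ⁻¹b, V) = -(σU, U) ≤ 0. By
symmetry of ε and μ⁻¹ the left side is the derivative of ½(εU, U) + ½(μ⁻¹V, V), which vanishes at t
= 0 and is positive definite. Hence U = V = 0, and e = b = 0 a.e. (`ae_eq_zero_of_energy`).

The analytic input is that an H¹ function of time with values in a Banach space is the primitive of
its weak derivative (`HasH1Deriv.ae_eq_integral`), and that μ⁻¹ acts as a bounded, symmetric,
coercive operator. -/

namespace Maxwell

/-! ### Absolute continuity of vector-valued primitives. -/

section AbsoluteContinuity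

variable {X Y : Type*} [NormedAddCommGroup X] [NormedAddCommGroup Y]

/-- Comparison of increments: it transfers absolute continuity from ∫‖w‖ to ∫w, and from a curve to
a quadratic form along it. -/
theorem _root_.AbsolutelyContinuousOnInterval.of_dist_le {f : ℝ → X} {g : ℝ → Y} {a b K : ℝ}
    (hg : AbsolutelyContinuousOnInterval g a b)
    (h : ∀ s ∈ uIcc a b, ∀ t ∈ uIcc a b, dist (f s) (f t) ≤ K * dist (g s) (g t)) :
    AbsolutelyContinuousOnInterval f a b := by
  rw [absolutelyContinuousOnInterval_iff] at hg ⊢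
  intro r hr
  -- K carries no sign condition, so it is replaced by a positive upper bound.
  have hK : 0 < |K| + 1 := by positivity
  obtain ⟨δ, hδ, H⟩ := hg (r / (|K| + 1)) (by positivity)
  refine ⟨δ, hδ, fun E hE hlen => ?_⟩
  have h1 := H E hE hlen
  calc ∑ i ∈ Finset.range E.1, dist (f (E.2 i).1) (f (E.2 i).2)
      ≤ ∑ i ∈ Finset.range E.1, (|K| + 1) * dist (g (E.2 i).1) (g (E.2 i).2) := by
        refine Finset.sum_le_sum fun i hi => ?_
        have hm := hE.1 i hi
        refine (h _ hm.1 _ hm.2).trans ?_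
        gcongr
        linarith [le_abs_self K]
    _ = (|K| + 1) * ∑ i ∈ Finset.range E.1, dist (g (E.2 i).1) (g (E.2 i).2) := by
        rw [Finset.mul_sum]
    _ < (|K| + 1) * (r / (|K| + 1)) := by gcongr
    _ = r := by field_simp

variable [NormedSpace ℝ X]

theorem absolutelyContinuousOnInterval_integral {w : ℝ → X} {a b : ℝ}
    (hw : IntervalIntegrable w volume a b) :
    AbsolutelyContinuousOnInterval (fun t => ∫ s in a..t, w s) a b := by
  have hn := hw.norm.absolutelyContinuousOnInterval_intervalIntegral left_mem_uIcc
  refine hn.of_dist_le (K := 1) fun s hs t ht => ?_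
  have hs' : IntervalIntegrable w volume a s := hw.mono_set (uIcc_subset_uIcc left_mem_uIcc hs)
  have ht' : IntervalIntegrable w volume a t := hw.mono_set (uIcc_subset_uIcc left_mem_uIcc ht)
  rw [one_mul, dist_eq_norm, dist_eq_norm, intervalIntegral.integral_interval_sub_left hs' ht',
    intervalIntegral.integral_interval_sub_left hs'.norm ht'.norm]
  exact intervalIntegral.norm_integral_le_abs_integral_norm

end AbsoluteContinuity

/-! ### Weak derivatives in time. -/

variable {X : Type*} [NormedAddCommGroup X] [NormedSpace ℝ X]

theorem integral_timeMeasure {T : ℝ} (hT : 0 ≤ T) (g : ℝ → X) :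
    ∫ t, g t ∂(timeMeasure T) = ∫ t in (0)..T, g t := by
  rw [timeMeasure, intervalIntegral.integral_of_le hT, integral_Ioc_eq_integral_Ioo]

theorem intervalIntegrable_of_timeMeasure {X : Type*} [NormedAddCommGroup X] {T : ℝ}
    (hT : 0 ≤ T) {g : ℝ → X}
    (hg : Integrable g (timeMeasure T)) : IntervalIntegrable g volume 0 T := by
  rw [intervalIntegrable_iff_integrableOn_Ioo_of_le hT]
  exact hg

theorem integrable_timeMeasure_of_continuousOn {X : Type*} [NormedAddCommGroup X] {T : ℝ}
    {g : ℝ → X}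
    (hg : ContinuousOn g (Icc 0 T)) : Integrable g (timeMeasure T) :=
  (hg.integrableOn_compact isCompact_Icc).mono_set Ioo_subset_Icc_self

instance (T : ℝ) : IsFiniteMeasure (timeMeasure T) := by
  unfold timeMeasure; infer_instance

theorem ae_timeMeasure_of_ae {T : ℝ} (hT : 0 ≤ T) {p : ℝ → Prop}
    (h : ∀ᵐ t, t ∈ uIcc 0 T → p t) : ∀ᵐ t ∂(timeMeasure T), p t := by
  rw [timeMeasure, ae_restrict_iff' measurableSet_Ioo]
  filter_upwards [h] with t ht ht'
  exact ht (by rw [uIcc_of_le hT]; exact Ioo_subset_Icc_self ht')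

/-- A test function of mean zero is the derivative of a test function. -/
theorem exists_primitive_isTestFunction {T : ℝ} {θ : ℝ → ℝ}
    (hθ : IsTestFunction (Ioo 0 T) θ) (h0 : ∫ t in (0)..T, θ t = 0) :
    ∃ ζ : ℝ → ℝ, IsTestFunction (Ioo 0 T) ζ ∧ deriv ζ = θ := by
  obtain ⟨hs, hc, hsub⟩ := hθ
  have hcont : Continuous θ := hs.continuous
  -- The primitive need not vanish in gaps of the support of θ, so its support is enclosed in an
  -- interval. If the support of θ is empty, the endpoints are arbitrary.
  obtain ⟨α, β, hα, hβ, hK⟩ : ∃ α β, 0 < α ∧ β < T ∧ tsupport θ ⊆ Icc α β := by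
    rcases (tsupport θ).eq_empty_or_nonempty with h | h
    · exact ⟨1, T - 1, one_pos, by linarith, by simp [h]⟩
    · obtain ⟨α, hα⟩ := hc.exists_isLeast h
      obtain ⟨β, hβ⟩ := hc.exists_isGreatest h
      exact ⟨α, β, (hsub hα.1).1, (hsub hβ.1).2, fun t ht => ⟨hα.2 ht, hβ.2 ht⟩⟩
  have hz : ∀ t, t ∉ Icc α β → θ t = 0 := fun t ht => image_eq_zero_of_notMem_tsupport
    fun h => ht (hK h)
  set ζ : ℝ → ℝ := fun t => ∫ s in (0)..t, θ s with hζ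
  have hd : ∀ t, HasDerivAt ζ (θ t) t := fun t =>
    intervalIntegral.integral_hasDerivAt_right (hcont.intervalIntegrable _ _)
      hcont.stronglyMeasurable.stronglyMeasurableAtFilter hcont.continuousAt
  have hderiv : deriv ζ = θ := funext fun t => (hd t).deriv
  have hsupp : Function.support ζ ⊆ Icc α β := by
    intro t ht
    by_contra hcon
    apply ht
    rw [mem_Icc, not_and_or, not_le, not_le] at hcon
    rcases hcon with h | h
    · refine intervalIntegral.integral_zero_ae (Filter.Eventually.of_forall fun s hs => ?_)
      refine hz s fun hs' => ?_
      rcases le_total 0 t with h0 | h0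
      · rw [uIoc_of_le h0] at hs; linarith [hs.2, hs'.1]
      · rw [uIoc_of_ge h0] at hs; linarith [hs.2, hs'.1]
    -- To the right of β the primitive equals its value at T, which is zero by the mean-zero
    -- hypothesis.
    · have h1 : ∫ s in t..T, θ s = 0 := by
        refine intervalIntegral.integral_zero_ae (Filter.Eventually.of_forall fun s hs => ?_)
        refine hz s fun hs' => ?_
        rcases le_total t T with h0 | h0
        · rw [uIoc_of_le h0] at hs; linarith [hs.1, hs'.2]
        · rw [uIoc_of_ge h0] at hs; linarith [hs.1, hs'.2]
      have := intervalIntegral.integral_add_adjacent_intervals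
        (hcont.intervalIntegrable (μ := volume) 0 t) (hcont.intervalIntegrable t T)
      rw [h1, h0, add_zero] at this
      exact this
  have hts : tsupport ζ ⊆ Icc α β := closure_minimal hsupp isClosed_Icc
  refine ⟨ζ, ⟨?_, HasCompactSupport.intro (K := Icc α β) isCompact_Icc fun t ht => ?_, hts.trans ?_⟩, hderiv⟩
  · rw [contDiff_infty_iff_deriv, hderiv]
    exact ⟨fun t => (hd t).differentiableAt, hs⟩
  · by_contra h
    exact ht (hsupp h)
  · exact fun t ht => ⟨hα.trans_le ht.1, ht.2.trans_lt hβ⟩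

theorem exists_isTestFunction_integral_eq_one {T : ℝ} (hT : 0 < T) :
    ∃ ρ : ℝ → ℝ, IsTestFunction (Ioo 0 T) ρ ∧ ∫ t in (0)..T, ρ t = 1 := by
  let b : ContDiffBump (T / 2) := ⟨T / 8, T / 4, by positivity, by linarith⟩
  have hsub : tsupport (b.normed volume) ⊆ Ioo 0 T := by
    rw [b.tsupport_normed_eq, Real.closedBall_eq_Icc]
    intro t ht
    have h1 := ht.1
    have h2 := ht.2
    simp only [b] at h1 h2
    constructor <;> linarith
  refine ⟨b.normed volume, ⟨b.contDiff_normed, b.hasCompactSupport_normed, hsub⟩, ?_⟩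
  rw [← b.integral_normed (μ := volume), intervalIntegral.integral_of_le hT.le]
  exact setIntegral_eq_integral_of_forall_compl_eq_zero fun t ht =>
    image_eq_zero_of_notMem_tsupport fun h => ht (Ioo_subset_Ioc_self (hsub h))

variable [CompleteSpace X]

/-- The lemma of du Bois-Reymond. -/
theorem exists_ae_eq_const_of_integral_deriv_smul_eq_zero {T : ℝ} (hT : 0 < T) {g : ℝ → X}
    (hg : Integrable g (timeMeasure T))
    (h : ∀ η : ℝ → ℝ, IsTestFunction (Ioo 0 T) η → ∫ t, deriv η t • g t ∂(timeMeasure T) = 0) :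
    ∃ c : X, ∀ᵐ t ∂(timeMeasure T), g t = c := by
  obtain ⟨ρ, hρ, hρ1⟩ := exists_isTestFunction_integral_eq_one hT
  have hint : ∀ η : ℝ → ℝ, IsTestFunction (Ioo 0 T) η →
      Integrable (fun t => η t • g t) (timeMeasure T) := fun η hη => by
    obtain ⟨C, hC⟩ := hη.1.continuous.bounded_above_of_compact_support hη.2.1
    exact hg.bdd_smul C hη.1.continuous.aestronglyMeasurable (Filter.Eventually.of_forall hC)
  have hint1 : ∀ η : ℝ → ℝ, IsTestFunction (Ioo 0 T) η → Integrable η (timeMeasure T) :=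
    fun η hη => integrable_timeMeasure_of_continuousOn hη.1.continuous.continuousOn
  -- The ρ-weighted mean of g is the only candidate for the constant, as ρ has integral one.
  set c : X := ∫ t, ρ t • g t ∂(timeMeasure T) with hcdef
  refine ⟨c, ?_⟩
  have key : ∀ η : ℝ → ℝ, IsTestFunction (Ioo 0 T) η →
      ∫ t, η t • (g t - c) ∂(timeMeasure T) = 0 := by
    intro η hη
    set m : ℝ := ∫ t, η t ∂(timeMeasure T) with hm
    -- Subtracting mρ removes the mean of η, so the hypothesis applies to the primitive of the
    -- result.
    have hθ : IsTestFunction (Ioo 0 T) (fun t => η t - m * ρ t) := by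
      refine ⟨hη.1.sub (contDiff_const.mul hρ.1), hη.2.1.sub hρ.2.1.mul_left, ?_⟩
      refine (tsupport_sub η (fun t => m * ρ t)).trans (union_subset hη.2.2 ?_)
      exact (closure_mono (Function.support_mul_subset_right (fun _ => m) ρ)).trans hρ.2.2
    obtain ⟨ζ, hζ, hd⟩ := exists_primitive_isTestFunction hθ (by
      rw [← integral_timeMeasure hT.le, integral_sub (hint1 η hη) ((hint1 ρ hρ).const_mul m),
        integral_const_mul, integral_timeMeasure hT.le ρ, hρ1, ← hm]; ring)
    have h2 := h ζ hζ
    rw [hd] at h2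
    have h3 : Integrable (fun t => m • ρ t • g t) (timeMeasure T) := (hint ρ hρ).smul m
    simp only [sub_smul, mul_smul] at h2
    rw [integral_sub (hint η hη) h3, integral_smul, ← hcdef] at h2
    simp only [smul_sub]
    rw [integral_sub (hint η hη) ((hint1 η hη).smul_const c), integral_smul_const, ← hm]
    exact h2
  have hloc : LocallyIntegrableOn (fun t => g t - c) (Ioo 0 T) volume :=
    IntegrableOn.locallyIntegrableOn (hg.sub (integrable_const c))
  have := isOpen_Ioo.ae_eq_zero_of_integral_contDiff_smul_eq_zero hloc fun η h1 h2 h3 => by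
    rw [← key η ⟨h1, h2, h3⟩, timeMeasure]
    refine (setIntegral_eq_integral_of_forall_compl_eq_zero fun t ht => ?_).symm
    rw [image_eq_zero_of_notMem_tsupport fun h => ht (h3 h), zero_smul]
  rw [timeMeasure, ae_restrict_iff' measurableSet_Ioo]
  filter_upwards [this] with t ht ht'
  exact sub_eq_zero.1 (ht ht')

/-- Integration by parts with a merely absolutely continuous factor W: the function ηW - ∫(ηw + η'W)
is absolutely continuous with zero derivative a.e., hence constant. It vanishes at 0, and η(T) = 0.
-/
theorem integral_deriv_smul_primitive {T : ℝ} (hT : 0 < T) {w : ℝ → X}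
    (hw : Integrable w (timeMeasure T)) {η : ℝ → ℝ} (hη : IsTestFunction (Ioo 0 T) η) :
    ∫ t, deriv η t • (∫ s in (0)..t, w s) ∂(timeMeasure T)
      = - ∫ t, η t • w t ∂(timeMeasure T) := by
  have hwi := intervalIntegrable_of_timeMeasure hT.le hw
  set W : ℝ → X := fun t => ∫ s in (0)..t, w s with hW
  have hWac : AbsolutelyContinuousOnInterval W 0 T := absolutelyContinuousOnInterval_integral hwi
  have hη1 : ContDiff ℝ 1 η := hη.1.of_le (by simp)
  have hηac : AbsolutelyContinuousOnInterval η 0 T := hη1.contDiffOn.absolutelyContinuousOnInterval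
  obtain ⟨C, hC⟩ := hη.1.continuous.bounded_above_of_compact_support hη.2.1
  have hi1 : Integrable (fun t => η t • w t) (timeMeasure T) :=
    hw.bdd_smul C hη.1.continuous.aestronglyMeasurable (Filter.Eventually.of_forall hC)
  have hi2 : Integrable (fun t => deriv η t • W t) (timeMeasure T) := by
    refine integrable_timeMeasure_of_continuousOn ?_
    refine (hη1.continuous_deriv le_rfl).continuousOn.smul ?_
    have := hWac.continuousOn
    rwa [uIcc_of_le hT.le] at this
  have hi := intervalIntegrable_of_timeMeasure hT.le (hi1.add hi2)
  have hac := (hηac.smul hWac).sub (absolutelyContinuousOnInterval_integral hi)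
  obtain ⟨c, hc⟩ := hac.const_of_ae_hasDerivAt_zero (by
    filter_upwards [hwi.ae_hasDerivAt_integral, hi.ae_hasDerivAt_integral] with t h1 h2 ht
    have := (((hη1.differentiable one_ne_zero t).hasDerivAt.smul (h1 ht 0 left_mem_uIcc))).sub
      (h2 ht 0 left_mem_uIcc)
    rwa [Pi.add_apply, sub_self] at this)
  have e0 := hc 0 left_mem_uIcc
  have eT := hc T right_mem_uIcc
  have hηT : η T = 0 := image_eq_zero_of_notMem_tsupport fun h => lt_irrefl _ (hη.2.2 h).2
  have hz : ∫ t, (η t • w t + deriv η t • W t) ∂(timeMeasure T) = 0 := by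
    rw [integral_timeMeasure hT.le]
    simp [hW] at e0
    simp [hηT, ← e0] at eT
    exact eT
  rw [integral_add hi1 hi2] at hz
  exact eq_neg_of_add_eq_zero_right hz

/-- A function in `H¹(0,T;X)` is the primitive of its weak derivative. -/
theorem HasH1Deriv.ae_eq_integral {T : ℝ} (hT : 0 < T) {u w : ℝ → X} {a : X}
    (h : HasH1Deriv T u w) (h0 : HasInitialValue T u a) :
    ∀ᵐ t ∂(timeMeasure T), u t = a + ∫ s in (0)..t, w s := by
  have hu : Integrable u (timeMeasure T) := h.memLp.integrable (by norm_num)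
  have hw : Integrable w (timeMeasure T) := h.memLp_deriv.integrable (by norm_num)
  have hWc : ContinuousOn (fun t => ∫ s in (0)..t, w s) (Icc 0 T) := by
    have := (absolutelyContinuousOnInterval_integral
      (intervalIntegrable_of_timeMeasure hT.le hw)).continuousOn
    rwa [uIcc_of_le hT.le] at this
  have hWi := integrable_timeMeasure_of_continuousOn hWc
  obtain ⟨k, hk⟩ := exists_ae_eq_const_of_integral_deriv_smul_eq_zero hT (hu.sub hWi)
    fun η hη => by
      obtain ⟨C, hC⟩ := (hη.1.continuous_deriv (by simp)).bounded_above_of_compact_support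
        hη.2.1.deriv
      have hm := (hη.1.continuous_deriv (by simp)).aestronglyMeasurable (μ := timeMeasure T)
      have hi1 : Integrable (fun t => deriv η t • u t) (timeMeasure T) :=
        hu.bdd_smul C hm (Filter.Eventually.of_forall hC)
      have hi2 : Integrable (fun t => deriv η t • ∫ s in (0)..t, w s) (timeMeasure T) :=
        hWi.bdd_smul C hm (Filter.Eventually.of_forall hC)
      simp only [Pi.sub_apply, smul_sub]
      rw [integral_sub hi1 hi2, h.integral_deriv η hη,
        integral_deriv_smul_primitive hT hw hη, sub_self]
  obtain ⟨c, hc, hcu, rfl⟩ := h0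
  -- Continuity upgrades the a.e. equality to all of [0,T]; evaluating at 0 identifies k with the
  -- initial value.
  have heq : EqOn (fun t => c t - ∫ s in (0)..t, w s) (fun _ => k) (Icc 0 T) := by
    have hae : (fun t => c t - ∫ s in (0)..t, w s) =ᵐ[volume.restrict (Icc 0 T)] fun _ => k := by
      rw [← restrict_Ioo_eq_restrict_Icc]
      filter_upwards [hk, hcu] with t h1 h2
      rw [h2]
      exact h1
    exact Measure.eqOn_Icc_of_ae_eq volume hT.ne hae (hc.sub hWc) continuousOn_const
  have hk0 : c 0 = k := by simpa using heq (left_mem_Icc.2 hT.le)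
  filter_upwards [hk] with t ht
  rw [hk0]
  exact sub_eq_iff_eq_add.1 ht

/-! ### Quadratic energies along absolutely continuous curves. -/

section Energy

variable {H : Type*} [NormedAddCommGroup H] [InnerProductSpace ℝ H]

/-- On the bounded range of v the quadratic form is Lipschitz: with ‖v‖ ≤ R, each half of the split
increment costs ‖A‖R. -/
theorem _root_.AbsolutelyContinuousOnInterval.inner_apply_self {v : ℝ → H} {a b : ℝ}
    (hv : AbsolutelyContinuousOnInterval v a b) (A : H →L[ℝ] H) :
    AbsolutelyContinuousOnInterval (fun t => inner ℝ (A (v t)) (v t)) a b := by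
  obtain ⟨R, hR⟩ := hv.exists_bound
  refine hv.of_dist_le (K := ‖A‖ * R + ‖A‖ * R) fun s hs t ht => ?_
  rw [Real.dist_eq, dist_eq_norm]
  have : inner ℝ (A (v s)) (v s) - inner ℝ (A (v t)) (v t)
      = inner ℝ (A (v s - v t)) (v s) + inner ℝ (A (v t)) (v s - v t) := by
    rw [map_sub, inner_sub_left, inner_sub_right]; ring
  rw [this]
  refine (abs_add_le _ _).trans ?_
  have h1 : |inner ℝ (A (v s - v t)) (v s)| ≤ ‖A‖ * R * ‖v s - v t‖ := by
    refine (abs_real_inner_le_norm _ _).trans ?_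
    calc ‖A (v s - v t)‖ * ‖v s‖ ≤ (‖A‖ * ‖v s - v t‖) * R := by
          gcongr
          exacts [A.le_opNorm _, hR s hs]
      _ = _ := by ring
  have h2 : |inner ℝ (A (v t)) (v s - v t)| ≤ ‖A‖ * R * ‖v s - v t‖ := by
    refine (abs_real_inner_le_norm _ _).trans ?_
    calc ‖A (v t)‖ * ‖v s - v t‖ ≤ (‖A‖ * R) * ‖v s - v t‖ := by
          gcongr
          exact (A.le_opNorm _).trans (by gcongr; exact hR t ht)
      _ = _ := by ring
  linarith

theorem _root_.HasDerivAt.inner_apply_self {v : ℝ → H} {v' : H} {t : ℝ}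
    (hv : HasDerivAt v v' t) (A : H →L[ℝ] H)
    (hA : ∀ x y, inner ℝ (A x) y = inner ℝ x (A y)) :
    HasDerivAt (fun t => inner ℝ (A (v t)) (v t)) (2 * inner ℝ (A v') (v t)) t := by
  have h1 : HasDerivAt (fun t => A (v t)) (A v') t := A.hasFDerivAt.comp_hasDerivAt t hv
  refine (h1.inner ℝ hv).congr_deriv ?_
  rw [hA (v t) v', real_inner_comm (A v')]
  ring

variable [CompleteSpace H]

/-- At almost every t the primitive has derivative e(t), yet it is zero near t. -/
theorem ae_eq_zero_of_integral_eq_zero {T : ℝ} (hT : 0 < T) {e : ℝ → H}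
    (he : Integrable e (timeMeasure T)) (h : ∀ t ∈ Icc 0 T, ∫ s in (0)..t, e s = 0) :
    e =ᵐ[timeMeasure T] 0 := by
  have hi := (intervalIntegrable_of_timeMeasure hT.le he).ae_hasDerivAt_integral
  rw [Filter.EventuallyEq, timeMeasure, ae_restrict_iff' measurableSet_Ioo]
  filter_upwards [hi] with t h1 ht
  have h2 := h1 (by rw [uIcc_of_le hT.le]; exact Ioo_subset_Icc_self ht) 0 left_mem_uIcc
  refine h2.unique ((hasDerivAt_const t (0 : H)).congr_of_eventuallyEq ?_)
  filter_upwards [isOpen_Ioo.mem_nhds ht] with s hs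
  exact h s (Ioo_subset_Icc_self hs)

/-- The energy argument: if the time derivative of
`½ (A ∫₀ᵗ e, ∫₀ᵗ e) + ½ (M ∫₀ᵗ b, ∫₀ᵗ b)` is nowhere positive, then `e` and `b` vanish. -/
theorem ae_eq_zero_of_energy {T : ℝ} (hT : 0 < T) {A M : H →L[ℝ] H}
    (hA : ∀ x y, inner ℝ (A x) y = inner ℝ x (A y))
    (hM : ∀ x y, inner ℝ (M x) y = inner ℝ x (M y))
    (hA0 : ∀ x, x ≠ 0 → 0 < inner ℝ (A x) x) (hM0 : ∀ x, x ≠ 0 → 0 < inner ℝ (M x) x)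
    {e b : ℝ → H} (he : Integrable e (timeMeasure T)) (hb : Integrable b (timeMeasure T))
    (h : ∀ᵐ t ∂(timeMeasure T), inner ℝ (A (e t)) (∫ s in (0)..t, e s)
      + inner ℝ (M (b t)) (∫ s in (0)..t, b s) ≤ 0) :
    e =ᵐ[timeMeasure T] 0 ∧ b =ᵐ[timeMeasure T] 0 := by
  have hei := intervalIntegrable_of_timeMeasure hT.le he
  have hbi := intervalIntegrable_of_timeMeasure hT.le hb
  set U : ℝ → H := fun t => ∫ s in (0)..t, e s with hU
  set V : ℝ → H := fun t => ∫ s in (0)..t, b s with hV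
  set F : ℝ → ℝ := fun t => inner ℝ (A (U t)) (U t) + inner ℝ (M (V t)) (V t) with hF
  have hac : AbsolutelyContinuousOnInterval F 0 T :=
    ((absolutelyContinuousOnInterval_integral hei).inner_apply_self A).add
      ((absolutelyContinuousOnInterval_integral hbi).inner_apply_self M)
  -- By symmetry of A and M, the derivative of F is twice the left side of `h`.
  have hderiv : ∀ᵐ t ∂(timeMeasure T), deriv F t ≤ 0 := by
    filter_upwards [h, ae_timeMeasure_of_ae hT.le hei.ae_hasDerivAt_integral,
      ae_timeMeasure_of_ae hT.le hbi.ae_hasDerivAt_integral] with t h0 h1 h2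
    have h3 := ((h1 0 left_mem_uIcc).inner_apply_self A hA).add
      ((h2 0 left_mem_uIcc).inner_apply_self M hM)
    have h4 : deriv F t = _ := h3.deriv
    rw [h4]
    linarith
  have hF0 : F 0 = 0 := by simp [hF, hU, hV]
  -- Absolute continuity is what allows F to be recovered from its a.e. derivative.
  have hneg : ∀ t ∈ Icc 0 T, F t ≤ 0 := by
    intro t ht
    have h1 := (hac.mono (c := 0) (d := t) (uIcc_subset_uIcc left_mem_uIcc
      (by rwa [uIcc_of_le hT.le]))).integral_deriv_eq_sub
    rw [hF0, sub_zero] at h1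
    rw [← h1, intervalIntegral.integral_of_le ht.1, integral_Ioc_eq_integral_Ioo]
    exact integral_nonpos_of_ae (ae_restrict_of_ae_restrict_of_subset
      (Ioo_subset_Ioo_right ht.2) hderiv)
  have hA1 : ∀ x, 0 ≤ inner ℝ (A x) x := fun x => by
    rcases eq_or_ne x 0 with rfl | hx
    exacts [by simp, (hA0 x hx).le]
  have hM1 : ∀ x, 0 ≤ inner ℝ (M x) x := fun x => by
    rcases eq_or_ne x 0 with rfl | hx
    exacts [by simp, (hM0 x hx).le]
  constructor
  · refine ae_eq_zero_of_integral_eq_zero hT he fun t ht => ?_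
    by_contra hne
    have h1 := hA0 _ hne
    have h2 := hM1 (V t)
    have h3 := hneg t ht
    simp only [hF, hU, hV] at h1 h2 h3
    linarith
  · refine ae_eq_zero_of_integral_eq_zero hT hb fun t ht => ?_
    by_contra hne
    have h1 := hM0 _ hne
    have h2 := hA1 (U t)
    have h3 := hneg t ht
    simp only [hF, hU, hV] at h1 h2 h3
    linarith

end Energy

/-! ### Coercive matrices and their inverses. -/

theorem act_add (A : Matrix (Fin 3) (Fin 3) ℝ) (u v : R3) : act A (u + v) = act A u + act A v := by
  simp [act, Matrix.mulVec_add]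

theorem act_smul (A : Matrix (Fin 3) (Fin 3) ℝ) (c : ℝ) (v : R3) : act A (c • v) = c • act A v := by
  simp [act, Matrix.mulVec_smul]

theorem act_act (A C : Matrix (Fin 3) (Fin 3) ℝ) (v : R3) : act A (act C v) = act (A * C) v := by
  simp [act, Matrix.mulVec_mulVec]

theorem act_one (v : R3) : act 1 v = v := by
  simp [act]

theorem inner_act_left (A : Matrix (Fin 3) (Fin 3) ℝ) (u v : R3) :
    inner ℝ (act A u) v = inner ℝ u (act A.transpose v) := by
  simp only [act, PiLp.inner_apply, Matrix.mulVec, dotProduct, Fin.sum_univ_three,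
    Matrix.transpose_apply, RCLike.inner_apply, conj_trivial]
  ring

theorem norm_act_le (A : Matrix (Fin 3) (Fin 3) ℝ) (v : R3) :
    ‖act A v‖ ≤ (∑ i, ∑ j, |A i j|) * ‖v‖ := by
  have h1 : ‖act A v‖ ≤ ∑ i, |act A v i| := by
    conv_lhs => rw [← (EuclideanSpace.basisFun (Fin 3) ℝ).sum_repr (act A v)]
    refine (norm_sum_le _ _).trans (Finset.sum_le_sum fun i _ => ?_)
    simp [norm_smul]
  refine h1.trans ?_
  rw [Finset.sum_mul]
  refine Finset.sum_le_sum fun i _ => ?_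
  rw [Finset.sum_mul]
  have : act A v i = ∑ j, A i j * v j := by simp [act, Matrix.mulVec, dotProduct]
  rw [this]
  refine (Finset.abs_sum_le_sum_abs _ _).trans (Finset.sum_le_sum fun j _ => ?_)
  rw [abs_mul]
  gcongr
  simpa using PiLp.norm_apply_le v j

section Coercive

variable {A : Matrix (Fin 3) (Fin 3) ℝ} {c : ℝ}

theorem isUnit_det_of_coercive (hc : 0 < c) (h : ∀ ξ : R3, c * ‖ξ‖ ^ 2 ≤ inner ℝ ξ (act A ξ)) :
    IsUnit A.det := by
  rw [← Matrix.isUnit_iff_isUnit_det, ← Matrix.mulVec_injective_iff_isUnit]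
  refine (injective_iff_map_eq_zero A.mulVecLin).2 fun v hv => ?_
  have h1 := h (WithLp.toLp 2 v)
  have h2 : act A (WithLp.toLp 2 v) = 0 := by
    simpa [act] using hv
  rw [h2, inner_zero_right] at h1
  have h3 : ‖WithLp.toLp 2 v‖ ^ 2 ≤ 0 := by
    by_contra hlt
    push Not at hlt
    linarith [mul_pos hc hlt]
  have h4 : ‖WithLp.toLp 2 v‖ = 0 := by
    have := sq_nonneg ‖WithLp.toLp 2 v‖
    exact pow_eq_zero_iff two_ne_zero |>.1 (le_antisymm h3 this)
  simpa using h4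

theorem act_act_inv (hA : IsUnit A.det) (v : R3) : act A (act A⁻¹ v) = v := by
  rw [act_act, Matrix.mul_nonsing_inv _ hA, act_one]

/-- With ξ = A⁻¹v, coercivity gives c|ξ|² ≤ (ξ, v) ≤ |ξ||v|; divide by |ξ|. -/
theorem norm_act_inv_le (hc : 0 < c) (h : ∀ ξ : R3, c * ‖ξ‖ ^ 2 ≤ inner ℝ ξ (act A ξ)) (v : R3) :
    ‖act A⁻¹ v‖ ≤ c⁻¹ * ‖v‖ := by
  have h1 := h (act A⁻¹ v)
  rw [act_act_inv (isUnit_det_of_coercive hc h)] at h1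
  have h2 := real_inner_le_norm (act A⁻¹ v) v
  rcases (norm_nonneg (act A⁻¹ v)).eq_or_lt with h0 | h0
  · rw [← h0]; positivity
  · rw [inv_mul_eq_div, le_div_iff₀ hc]
    have h3 : ‖act A⁻¹ v‖ * (‖act A⁻¹ v‖ * c) ≤ ‖act A⁻¹ v‖ * ‖v‖ := by nlinarith
    exact le_of_mul_le_mul_left h3 h0

/-- With ξ = A⁻¹v, (v, A⁻¹v) = (ξ, Aξ) ≥ c|ξ|², while |v| = |Aξ| ≤ K|ξ|. -/
theorem coercive_inv (hc : 0 < c) (h : ∀ ξ : R3, c * ‖ξ‖ ^ 2 ≤ inner ℝ ξ (act A ξ)) {K : ℝ}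
    (hK : 0 < K) (hAK : ∀ ξ, ‖act A ξ‖ ≤ K * ‖ξ‖) (v : R3) :
    c / K ^ 2 * ‖v‖ ^ 2 ≤ inner ℝ v (act A⁻¹ v) := by
  have h1 := h (act A⁻¹ v)
  have h2 := hAK (act A⁻¹ v)
  rw [act_act_inv (isUnit_det_of_coercive hc h)] at h1 h2
  rw [real_inner_comm]
  refine le_trans ?_ h1
  have h3 : ‖v‖ ^ 2 ≤ K ^ 2 * ‖act A⁻¹ v‖ ^ 2 := by
    rw [← mul_pow]; gcongr
  calc c / K ^ 2 * ‖v‖ ^ 2 ≤ c / K ^ 2 * (K ^ 2 * ‖act A⁻¹ v‖ ^ 2) := by gcongr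
    _ = c * ‖act A⁻¹ v‖ ^ 2 := by field_simp

end Coercive

/-! ### Bounded tensor fields as operators on L²(Ω)³. -/

namespace LinftyTensor

variable {Ω : Set R3} (A : LinftyTensor Ω)

theorem exists_bound :
    ∃ K : ℝ, 0 < K ∧ ∀ᵐ x ∂(volume.restrict Ω), ∀ v : R3, ‖act (A.toFun x) v‖ ≤ K * ‖v‖ := by
  have h : ∀ i j, ∃ C : ℝ, ∀ᵐ x ∂(volume.restrict Ω), |A.toFun x i j| ≤ C := fun i j => by
    have hfin := (A.memLp i j).eLpNorm_lt_top
    rw [eLpNorm_exponent_top] at hfin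
    refine ⟨(eLpNormEssSup (fun x => A.toFun x i j) (volume.restrict Ω)).toReal, ?_⟩
    filter_upwards [ae_le_eLpNormEssSup (f := fun x => A.toFun x i j)
      (μ := volume.restrict Ω)] with x hx
    have := ENNReal.toReal_mono hfin.ne hx
    rwa [toReal_enorm, Real.norm_eq_abs] at this
  choose C hC using h
  refine ⟨|∑ i, ∑ j, C i j| + 1, by positivity, ?_⟩
  filter_upwards [ae_all_iff.2 fun i => ae_all_iff.2 fun j => hC i j] with x hx v
  refine (norm_act_le _ _).trans ?_
  gcongr
  refine le_trans ?_ ((le_abs_self _).trans (le_add_of_nonneg_right zero_le_one))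
  exact Finset.sum_le_sum fun i _ => Finset.sum_le_sum fun j _ => hx i j

theorem coeFn_mul (v : L2 Ω) :
    A.mul v =ᵐ[volume.restrict Ω] fun x => act (A.toFun x) (v x) :=
  (A.memLp_act v).coeFn_toLp

/-- Multiplication by a bounded tensor field, as an operator on `L²(Ω)³`. -/
noncomputable def mulCLM : L2 Ω →L[ℝ] L2 Ω :=
  LinearMap.mkContinuousOfExistsBound
    { toFun := A.mul
      map_add' := fun u v => by
        refine Lp.ext ?_
        filter_upwards [A.coeFn_mul (u + v), A.coeFn_mul u, A.coeFn_mul v, Lp.coeFn_add u v,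
          Lp.coeFn_add (A.mul u) (A.mul v)] with x h1 h2 h3 h4 h5
        rw [h1, h5, Pi.add_apply, h2, h3, h4, Pi.add_apply, act_add]
      map_smul' := fun c u => by
        refine Lp.ext ?_
        filter_upwards [A.coeFn_mul (c • u), A.coeFn_mul u, Lp.coeFn_smul c u,
          Lp.coeFn_smul c (A.mul u)] with x h1 h2 h3 h4
        rw [h1, RingHom.id_apply, h4, Pi.smul_apply, h2, h3, Pi.smul_apply, act_smul] }
    (by
      obtain ⟨K, -, h⟩ := A.exists_bound
      refine ⟨K, fun v => Lp.norm_le_mul_norm_of_ae_le_mul ?_⟩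
      filter_upwards [h, A.coeFn_mul v] with x h1 h2
      exact (congrArg norm h2).trans_le (h1 (v x)))

theorem mulCLM_apply (v : L2 Ω) : A.mulCLM v = A.mul v := rfl

variable {A}

theorem IsSymmetric.inner_mulCLM (h : A.IsSymmetric) (u v : L2 Ω) :
    inner ℝ (A.mulCLM u) v = inner ℝ u (A.mulCLM v) := by
  rw [L2.inner_def, L2.inner_def]
  refine integral_congr_ae ?_
  filter_upwards [h, A.coeFn_mul u, A.coeFn_mul v] with x h1 h2 h3
  rw [mulCLM_apply, mulCLM_apply, h2, h3, inner_act_left, h1]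

theorem IsBoundedBelow.le_inner_mulCLM {c : ℝ} (h : A.IsBoundedBelow c) (u : L2 Ω) :
    c * ‖u‖ ^ 2 ≤ inner ℝ (A.mulCLM u) u := by
  rw [← real_inner_self_eq_norm_sq, L2.inner_def, L2.inner_def, ← integral_const_mul]
  refine integral_mono_ae ((L2.integrable_inner u u).const_mul c)
    (L2.integrable_inner (A.mulCLM u) u) ?_
  filter_upwards [h, A.coeFn_mul u] with x h1 h2
  rw [mulCLM_apply, h2, real_inner_self_eq_norm_sq, real_inner_comm]
  exact h1 (u x)

theorem IsBoundedBelow.inner_mulCLM_pos {c : ℝ} (hc : 0 < c) (h : A.IsBoundedBelow c) (u : L2 Ω)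
    (hu : u ≠ 0) : 0 < inner ℝ (A.mulCLM u) u :=
  lt_of_lt_of_le (by positivity) (h.le_inner_mulCLM u)

/-- The field of inverses of a uniformly positive tensor field. -/
noncomputable def IsBoundedBelow.inv {c : ℝ} (hc : 0 < c) (h : A.IsBoundedBelow c) : LinftyTensor Ω where
  toFun x := (A.toFun x)⁻¹
  memLp i j := by
    refine memLp_top_of_bound (C := c⁻¹) ?_ ?_
    · have hm : ∀ i j, AEMeasurable (fun x => A.toFun x i j) (volume.restrict Ω) :=
        fun i j => (A.memLp i j).aestronglyMeasurable.aemeasurable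
      refine AEMeasurable.aestronglyMeasurable ?_
      have h0 := fun j => hm 0 j
      have h1 := fun j => hm 1 j
      have h2 := fun j => hm 2 j
      have hdet : AEMeasurable (fun x => ((A.toFun x).det)⁻¹) (volume.restrict Ω) := by
        simp only [Matrix.det_fin_three]
        fun_prop
      -- By Cramer's rule the entries are polynomials in the entries of A divided by the
      -- determinant, hence measurable.
      simp only [Matrix.inv_def, Ring.inverse_eq_inv', Matrix.smul_apply, smul_eq_mul]
      refine hdet.mul ?_
      simp only [Matrix.adjugate_fin_three]
      fin_cases i <;> fin_cases j <;> simp <;> fun_prop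
    · filter_upwards [h] with x hx
      -- The (i, j) entry is the i-th component of A⁻¹ applied to the j-th unit vector.
      have h1 := norm_act_inv_le hc hx (EuclideanSpace.single j 1)
      have h2 := (PiLp.norm_apply_le (act (A.toFun x)⁻¹ (EuclideanSpace.single j 1)) i).trans h1
      simpa [act] using h2

theorem IsBoundedBelow.isSymmetric_inv {c : ℝ} (hc : 0 < c) (h : A.IsBoundedBelow c)
    (hA : A.IsSymmetric) : (h.inv hc).IsSymmetric := by
  filter_upwards [hA] with x hx
  exact hx.inv

theorem IsBoundedBelow.exists_isBoundedBelow_inv {c : ℝ} (hc : 0 < c) (h : A.IsBoundedBelow c) :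
    ∃ c' : ℝ, 0 < c' ∧ (h.inv hc).IsBoundedBelow c' := by
  obtain ⟨K, hK, hb⟩ := A.exists_bound
  refine ⟨c / K ^ 2, by positivity, ?_⟩
  filter_upwards [h, hb] with x h1 h2
  exact coercive_inv hc h1 hK h2

/-- Expressing the pairing through a bounded operator lets time integrals pass through it. -/
theorem IsBoundedBelow.invPairing_eq {c : ℝ} (hc : 0 < c) (h : A.IsBoundedBelow c) (u v : L2 Ω) :
    A.invPairing u v = inner ℝ ((h.inv hc).mulCLM u) v := by
  rw [invPairing, L2.inner_def]
  refine integral_congr_ae ?_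
  filter_upwards [(h.inv hc).coeFn_mul u] with x hx
  rw [mulCLM_apply, hx]
  rfl

end LinftyTensor

/-! ### Smooth fields in `H(curl; Ω)` -/

section SmoothFields

theorem continuous_partialDeriv {φ : R3 → R3} (h : ContDiff ℝ ∞ φ) (j i : Fin 3) :
    Continuous (partialDeriv φ j i) := by
  have hf : Continuous (fderiv ℝ φ) := h.continuous_fderiv (by simp)
  unfold partialDeriv
  fun_prop

theorem hasCompactSupport_partialDeriv {φ : R3 → R3} (h : HasCompactSupport φ) (j i : Fin 3) :
    HasCompactSupport (partialDeriv φ j i) := by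
  refine (h.fderiv (𝕜 := ℝ)).mono fun x hx => ?_
  contrapose! hx
  have h0 : fderiv ℝ φ x = 0 := by simpa using hx
  simp [partialDeriv, h0]

theorem partialDeriv_eq {φ : R3 → R3} (h : ContDiff ℝ ∞ φ) (j i : Fin 3) (x : R3) :
    partialDeriv φ j i x = fderiv ℝ (fun y => φ y i) x (EuclideanSpace.single j 1) := by
  have h1 : HasFDerivAt (fun y => φ y i) ((EuclideanSpace.proj i).comp (fderiv ℝ φ x)) x :=
    (EuclideanSpace.proj i : R3 →L[ℝ] ℝ).hasFDerivAt.comp x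
      (h.differentiable (by simp) x).hasFDerivAt
  rw [h1.fderiv]
  rfl

theorem hasCompactSupport_apply {φ : R3 → R3} (h : HasCompactSupport φ) (i : Fin 3) :
    HasCompactSupport fun x => φ x i :=
  h.comp_left (g := fun v : R3 => v i) rfl

/-- Compact support of φ alone makes all the products integrable, so there is no boundary term. -/
theorem integral_mul_partialDeriv {φ ψ : R3 → R3} (hφ : ContDiff ℝ ∞ φ) (hψ : ContDiff ℝ ∞ ψ)
    (hφc : HasCompactSupport φ) (i j k : Fin 3) :
    ∫ x, φ x i * partialDeriv ψ j k x = - ∫ x, partialDeriv φ j i x * ψ x k := by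
  have hci : ∀ {θ : R3 → R3}, ContDiff ℝ ∞ θ → ∀ i, Continuous fun x => θ x i := fun hθ i => by
    have := hθ.continuous
    fun_prop
  have hdi : ∀ {θ : R3 → R3}, ContDiff ℝ ∞ θ → ∀ i, Differentiable ℝ fun x => θ x i :=
    fun hθ i => by
      have := hθ.differentiable (by simp)
      fun_prop
  simp only [partialDeriv_eq hψ, partialDeriv_eq hφ]
  apply integral_mul_fderiv_eq_neg_fderiv_mul_of_integrable
  · simp only [← partialDeriv_eq hφ]
    exact ((continuous_partialDeriv hφ j i).mul (hci hψ k)).integrable_of_hasCompactSupport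
      (hasCompactSupport_partialDeriv hφc j i).mul_right
  · simp only [← partialDeriv_eq hψ]
    exact ((hci hφ i).mul (continuous_partialDeriv hψ j k)).integrable_of_hasCompactSupport
      (hasCompactSupport_apply hφc i).mul_right
  · exact ((hci hφ i).mul (hci hψ k)).integrable_of_hasCompactSupport
      (hasCompactSupport_apply hφc i).mul_right
  · exact fun x _ => hdi hφ i x
  · exact fun x _ => hdi hψ k x

theorem integral_sub_add_sub_add_sub {α : Type*} [MeasurableSpace α] {ν : Measure α}
    {a b c d e f : α → ℝ} (ha : Integrable a ν) (hb : Integrable b ν) (hc : Integrable c ν)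
    (hd : Integrable d ν) (he : Integrable e ν) (hf : Integrable f ν) :
    ∫ x, ((a x - b x) + (c x - d x)) + (e x - f x) ∂ν
      = ((∫ x, a x ∂ν - ∫ x, b x ∂ν) + (∫ x, c x ∂ν - ∫ x, d x ∂ν))
        + (∫ x, e x ∂ν - ∫ x, f x ∂ν) := by
  have h1 : Integrable (fun x => a x - b x) ν := ha.sub hb
  have h2 : Integrable (fun x => c x - d x) ν := hc.sub hd
  have h3 : Integrable (fun x => e x - f x) ν := he.sub hf
  have h4 : Integrable (fun x => (a x - b x) + (c x - d x)) ν := h1.add h2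
  rw [integral_add h4 h3, integral_add h1 h2, integral_sub ha hb, integral_sub hc hd,
    integral_sub he hf]

/-- Green's formula for the curl. -/
theorem integral_inner_curl {φ ψ : R3 → R3} (hφ : ContDiff ℝ ∞ φ) (hψ : ContDiff ℝ ∞ ψ)
    (hφc : HasCompactSupport φ) :
    ∫ x, inner ℝ (curl φ x) (ψ x) = ∫ x, inner ℝ (φ x) (curl ψ x) := by
  have hI : ∀ i j k, Integrable (fun x => φ x i * partialDeriv ψ j k x) := fun i j k => by
    have := hφ.continuous
    exact (Continuous.mul (by fun_prop)
      (continuous_partialDeriv hψ j k)).integrable_of_hasCompactSupport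
      (hasCompactSupport_apply hφc i).mul_right
  have hJ : ∀ i j k, Integrable (fun x => partialDeriv φ j i x * ψ x k) := fun i j k => by
    have := hψ.continuous
    exact ((continuous_partialDeriv hφ j i).mul (by fun_prop)).integrable_of_hasCompactSupport
      (hasCompactSupport_partialDeriv hφc j i).mul_right
  have e1 : ∀ x, inner ℝ (curl φ x) (ψ x)
      = ((partialDeriv φ 1 2 x * ψ x 0 - partialDeriv φ 2 1 x * ψ x 0)
        + (partialDeriv φ 2 0 x * ψ x 1 - partialDeriv φ 0 2 x * ψ x 1))
        + (partialDeriv φ 0 1 x * ψ x 2 - partialDeriv φ 1 0 x * ψ x 2) := fun x => by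
    simp [PiLp.inner_apply, Fin.sum_univ_three, curl]
    ring
  have e2 : ∀ x, inner ℝ (φ x) (curl ψ x)
      = ((φ x 0 * partialDeriv ψ 1 2 x - φ x 0 * partialDeriv ψ 2 1 x)
        + (φ x 1 * partialDeriv ψ 2 0 x - φ x 1 * partialDeriv ψ 0 2 x))
        + (φ x 2 * partialDeriv ψ 0 1 x - φ x 2 * partialDeriv ψ 1 0 x) := fun x => by
    simp [PiLp.inner_apply, Fin.sum_univ_three, curl]
    ring
  simp only [e1, e2]
  rw [integral_sub_add_sub_add_sub (hJ _ _ _) (hJ _ _ _) (hJ _ _ _) (hJ _ _ _) (hJ _ _ _)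
    (hJ _ _ _), integral_sub_add_sub_add_sub (hI _ _ _) (hI _ _ _) (hI _ _ _) (hI _ _ _)
    (hI _ _ _) (hI _ _ _)]
  simp only [integral_mul_partialDeriv hφ hψ hφc]
  ring

variable {Ω : Set R3}

/-- The pair `(φ, curl φ)` for a field `φ ∈ C_c^∞(ℝ³)³`. -/
noncomputable def smoothPair (Ω : Set R3) {φ : R3 → R3} (h : IsTestFunction univ φ) :
    WithLp 2 (L2 Ω × L2 Ω) :=
  WithLp.toLp 2 ((memLp_of_continuous Ω h.1.continuous h.2.1).toLp φ,
    (memLp_of_continuous Ω (continuous_curl h.1) (hasCompactSupport_curl h.2.1)).toLp (curl φ))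

theorem support_curl_subset (ψ : R3 → R3) : Function.support (curl ψ) ⊆ tsupport ψ := by
  intro x hx
  by_contra hcon
  apply hx
  have h0 : fderiv ℝ ψ x = 0 := image_eq_zero_of_notMem_tsupport fun h =>
    hcon (tsupport_fderiv_subset ℝ (f := ψ) h)
  ext i
  fin_cases i <;> simp [curl, partialDeriv, h0]

/-- The test fields live inside Ω, so both integrals extend to ℝ³, where Green's formula has no
boundary term. -/
theorem smoothPair_mem_Hcurl {φ : R3 → R3} (h : IsTestFunction univ φ) :
    smoothPair Ω h ∈ Hcurl Ω := by
  intro ψ hψ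
  have e1 : ∫ x in Ω, inner ℝ ((smoothPair Ω h).snd x) (ψ x) = ∫ x, inner ℝ (curl φ x) (ψ x) := by
    refine Eq.trans ?_ (setIntegral_eq_integral_of_forall_compl_eq_zero (s := Ω) ?_)
    · refine integral_congr_ae ?_
      filter_upwards [(memLp_of_continuous Ω (continuous_curl h.1)
        (hasCompactSupport_curl h.2.1)).coeFn_toLp] with x hx
      exact congrArg (fun v => inner ℝ v (ψ x)) hx
    · intro x hx
      rw [image_eq_zero_of_notMem_tsupport fun h => hx (hψ.2.2 h), inner_zero_right]
  have e2 : ∫ x in Ω, inner ℝ ((smoothPair Ω h).fst x) (curl ψ x)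
      = ∫ x, inner ℝ (φ x) (curl ψ x) := by
    refine Eq.trans ?_ (setIntegral_eq_integral_of_forall_compl_eq_zero (s := Ω) ?_)
    · refine integral_congr_ae ?_
      filter_upwards [(memLp_of_continuous Ω h.1.continuous h.2.1).coeFn_toLp] with x hx
      exact congrArg (fun v => inner ℝ v (curl ψ x)) hx
    · intro x hx
      have : curl ψ x = 0 := by
        by_contra h0
        exact hx (hψ.2.2 (support_curl_subset ψ h0))
      rw [this, inner_zero_right]
  rw [greenDefect, e1, e2, integral_inner_curl h.1 hψ.1 h.2.1, sub_self]

/-- `curl v = w` with vanishing tangential trace, if Green's formula holds against all of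
`H(curl; Ω)`. -/
theorem mem_Hcurl0_of_forall_inner_eq {p : WithLp 2 (L2 Ω × L2 Ω)}
    (h : ∀ φ : Hcurl Ω, inner ℝ p.snd φ.1.fst = inner ℝ p.fst φ.1.snd) : p ∈ Hcurl0 Ω := by
  -- Smooth fields on ℝ³ restrict to elements of H(curl; Ω), so they are admissible in `h`. Test
  -- fields supported in Ω are a special case.
  have key : p ∈ greenSpace Ω univ := fun φ hφ => by
    rw [greenDefect_eq Ω p hφ, sub_eq_zero]
    exact h ⟨smoothPair Ω hφ, smoothPair_mem_Hcurl hφ⟩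
  exact ⟨fun φ hφ => key φ ⟨hφ.1, hφ.2.1, subset_univ _⟩, key⟩

end SmoothFields

/-! ### Maxwell's equations integrated in time. -/

section WeakSolution

variable {Ω : Set R3} {T : ℝ} {ε σ μ : LinftyTensor Ω} {f : ℝ → L2 Ω} {E₀ B₀ : L2 Ω}
  {E B : ℝ → L2 Ω}

theorem IsWeakSolution.integrable_E (h : IsWeakSolution T ε σ μ f E₀ B₀ E B) :
    Integrable E (timeMeasure T) := h.E_bounded.integrable le_top

theorem IsWeakSolution.integrable_B (h : IsWeakSolution T ε σ μ f E₀ B₀ E B) :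
    Integrable B (timeMeasure T) := h.B_bounded.integrable le_top

theorem toDual_apply (V : Submodule ℝ (WithLp 2 (L2 Ω × L2 Ω))) (u : L2 Ω) (ψ : V) :
    toDual V u ψ = inner ℝ u ψ.1.fst := rfl

theorem intervalIntegrable_of_mem_Ioo {X : Type*} [NormedAddCommGroup X] {g : ℝ → X}
    (hg : Integrable g (timeMeasure T)) {t : ℝ} (ht : t ∈ Ioo 0 T) :
    IntervalIntegrable g volume 0 t :=
  (intervalIntegrable_of_timeMeasure (ht.1.trans ht.2).le hg).mono_set
    (uIcc_subset_uIcc left_mem_uIcc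
      (by rw [uIcc_of_le (ht.1.trans ht.2).le]; exact Ioo_subset_Icc_self ht))

theorem ae_uIoc_of_ae_timeMeasure {p : ℝ → Prop} (h : ∀ᵐ s ∂(timeMeasure T), p s) {t : ℝ}
    (ht : t ∈ Ioo 0 T) : ∀ᵐ s, s ∈ uIoc 0 t → p s := by
  rw [timeMeasure, ae_restrict_iff' measurableSet_Ioo] at h
  filter_upwards [h] with s hs hst
  rw [uIoc_of_le ht.1.le] at hst
  exact hs ⟨hst.1, hst.2.trans_lt ht.2⟩

theorem ae_mem_Ioo_timeMeasure (T : ℝ) : ∀ᵐ t ∂(timeMeasure T), t ∈ Ioo 0 T :=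
  ae_restrict_mem measurableSet_Ioo

theorem HasH1Deriv.integrable_deriv {X : Type*} [NormedAddCommGroup X] [NormedSpace ℝ X]
    {u w : ℝ → X} (h : HasH1Deriv T u w) : Integrable w (timeMeasure T) :=
  h.memLp_deriv.integrable (by norm_num)

/-- Ampère's law, integrated in time. -/
theorem IsWeakSolution.ampere_integrated (hT : 0 < T) (h : IsWeakSolution T ε σ μ f E₀ B₀ E B)
    (hf : MemLp f 2 (timeMeasure T)) {M : L2 Ω →L[ℝ] L2 Ω}
    (hM : ∀ u v, μ.invPairing u v = inner ℝ (M u) v) :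
    ∀ᵐ t ∂(timeMeasure T), ∀ ψ : Hcurl0 Ω,
      inner ℝ (ε.mulCLM (E t)) ψ.1.fst = inner ℝ (ε.mulCLM E₀) ψ.1.fst
        + inner ℝ (∫ s in (0)..t, f s) ψ.1.fst
        - inner ℝ (σ.mulCLM (∫ s in (0)..t, E s)) ψ.1.fst
        + inner ℝ (M (∫ s in (0)..t, B s)) ψ.1.snd := by
  obtain ⟨D, hD, hlaw⟩ := h.ampere
  have hDi := hD.integrable_deriv
  -- `h1` is an identity in the dual space, so the exceptional null set does not depend on ψ. This
  -- later permits a test field that varies with t.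
  filter_upwards [hD.ae_eq_integral hT h.E_initial, ae_mem_Ioo_timeMeasure T] with t h1 ht ψ
  have h2 := congrArg (fun L : StrongDual ℝ (Hcurl0 Ω) => L ψ) h1
  simp only [add_apply, toDual_apply] at h2
  rw [ContinuousLinearMap.intervalIntegral_apply (intervalIntegrable_of_mem_Ioo hDi ht)] at h2
  rw [LinftyTensor.mulCLM_apply, LinftyTensor.mulCLM_apply, h2]
  have hfi := intervalIntegrable_of_mem_Ioo (hf.integrable (by norm_num)) ht
  have hEi := intervalIntegrable_of_mem_Ioo h.integrable_E ht
  have hBi := intervalIntegrable_of_mem_Ioo h.integrable_B ht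
  -- Continuous linear functionals commute with the time integral, which moves it onto f, E and B.
  let L₁ : L2 Ω →L[ℝ] ℝ := innerSL ℝ ψ.1.fst
  let L₂ : L2 Ω →L[ℝ] ℝ := (innerSL ℝ ψ.1.fst).comp σ.mulCLM
  let L₃ : L2 Ω →L[ℝ] ℝ := (innerSL ℝ ψ.1.snd).comp M
  have e1 : ∫ s in (0)..t, D s ψ = ∫ s in (0)..t, (L₁ (f s) - L₂ (E s) + L₃ (B s)) := by
    refine intervalIntegral.integral_congr_ae ?_
    filter_upwards [ae_uIoc_of_ae_timeMeasure hlaw ht] with s hs hst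
    have h3 := hs hst ψ
    rw [hM] at h3
    simp only [L₁, L₂, L₃, ContinuousLinearMap.comp_apply, innerSL_apply_apply,
      LinftyTensor.mulCLM_apply]
    rw [real_inner_comm, real_inner_comm _ ψ.1.fst, real_inner_comm _ ψ.1.snd]
    linarith
  have i1 : IntervalIntegrable (fun s => L₁ (f s)) volume 0 t :=
    ⟨L₁.integrable_comp hfi.1, L₁.integrable_comp hfi.2⟩
  have i2 : IntervalIntegrable (fun s => L₂ (E s)) volume 0 t :=
    ⟨L₂.integrable_comp hEi.1, L₂.integrable_comp hEi.2⟩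
  have i3 : IntervalIntegrable (fun s => L₃ (B s)) volume 0 t :=
    ⟨L₃.integrable_comp hBi.1, L₃.integrable_comp hBi.2⟩
  rw [e1, intervalIntegral.integral_add (i1.sub i2) i3, intervalIntegral.integral_sub i1 i2,
    L₁.intervalIntegral_comp_comm hfi, L₂.intervalIntegral_comp_comm hEi,
    L₃.intervalIntegral_comp_comm hBi]
  simp only [L₁, L₂, L₃, ContinuousLinearMap.comp_apply, innerSL_apply_apply]
  rw [real_inner_comm ψ.1.fst (∫ s in (0)..t, f s),
    real_inner_comm ψ.1.fst (σ.mulCLM (∫ s in (0)..t, E s)), real_inner_comm ψ.1.snd]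
  ring

/-- Faraday's law, integrated in time. -/
theorem IsWeakSolution.faraday_integrated (hT : 0 < T)
    (h : IsWeakSolution T ε σ μ f E₀ B₀ E B) :
    ∀ᵐ t ∂(timeMeasure T), ∀ φ : Hcurl Ω,
      inner ℝ (B t) φ.1.fst = inner ℝ B₀ φ.1.fst - inner ℝ (∫ s in (0)..t, E s) φ.1.snd := by
  obtain ⟨D, hD, hlaw⟩ := h.faraday
  have hDi := hD.integrable_deriv
  filter_upwards [hD.ae_eq_integral hT h.B_initial, ae_mem_Ioo_timeMeasure T] with t h1 ht φ
  have h2 := congrArg (fun L : StrongDual ℝ (Hcurl Ω) => L φ) h1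
  simp only [add_apply, toDual_apply] at h2
  rw [ContinuousLinearMap.intervalIntegral_apply (intervalIntegrable_of_mem_Ioo hDi ht)] at h2
  rw [h2]
  let L : L2 Ω →L[ℝ] ℝ := innerSL ℝ φ.1.snd
  have e1 : ∫ s in (0)..t, D s φ = ∫ s in (0)..t, -L (E s) := by
    refine intervalIntegral.integral_congr_ae ?_
    filter_upwards [ae_uIoc_of_ae_timeMeasure hlaw ht] with s hs hst
    have h3 := hs hst φ
    simp only [L, innerSL_apply_apply]
    rw [real_inner_comm]
    linarith
  rw [e1, intervalIntegral.integral_neg,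
    L.intervalIntegral_comp_comm (intervalIntegrable_of_mem_Ioo h.integrable_E ht)]
  simp only [L, innerSL_apply_apply]
  rw [real_inner_comm φ.1.snd]
  ring

end WeakSolution

end Maxwell

/-! ### Uniqueness. -/

theorem theorem3p2 (Ω : Set Maxwell.R3) (hΩ : Maxwell.IsBoundedLipschitzDomain Ω)
    (T : ℝ) (hT : 0 < T)
    (ε σ μ : Maxwell.LinftyTensor Ω)
    (hε_symm : ε.IsSymmetric) (hσ_symm : σ.IsSymmetric) (hμ_symm : μ.IsSymmetric)
    (hε : ∃ ε₀ : ℝ, 0 < ε₀ ∧ ε.IsBoundedBelow ε₀)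
    (hμ : ∃ μ₀ : ℝ, 0 < μ₀ ∧ μ.IsBoundedBelow μ₀)
    (hσ : σ.IsBoundedBelow 0)
    (f : ℝ → Maxwell.L2 Ω) (hf : MemLp f 2 (Maxwell.timeMeasure T))
    (E₀ B₀ : Maxwell.L2 Ω)
    (E₁ B₁ E₂ B₂ : ℝ → Maxwell.L2 Ω)
    (h₁ : Maxwell.IsWeakSolution T ε σ μ f E₀ B₀ E₁ B₁)
    (h₂ : Maxwell.IsWeakSolution T ε σ μ f E₀ B₀ E₂ B₂) :
    E₁ =ᵐ[Maxwell.timeMeasure T] E₂ ∧ B₁ =ᵐ[Maxwell.timeMeasure T] B₂ := by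
  obtain ⟨ε₀, hε₀, hε⟩ := hε
  obtain ⟨μ₀, hμ₀, hμ⟩ := hμ
  obtain ⟨c, hc, hinv⟩ := hμ.exists_isBoundedBelow_inv hμ₀
  have hMsymm := (hμ.isSymmetric_inv hμ₀ hμ_symm).inner_mulCLM
  set M := (hμ.inv hμ₀).mulCLM with hM
  have hpair : ∀ u v, μ.invPairing u v = inner ℝ (M u) v := hμ.invPairing_eq hμ₀
  have hzero := Maxwell.ae_eq_zero_of_energy hT (A := ε.mulCLM) (M := M)
    hε_symm.inner_mulCLM hMsymm (hε.inner_mulCLM_pos hε₀) (hinv.inner_mulCLM_pos hc)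
    (h₁.integrable_E.sub h₂.integrable_E) (h₁.integrable_B.sub h₂.integrable_B) (by
      filter_upwards [h₁.ampere_integrated hT hf hpair, h₂.ampere_integrated hT hf hpair,
        h₁.faraday_integrated hT, h₂.faraday_integrated hT,
        Maxwell.ae_mem_Ioo_timeMeasure T] with t a₁ a₂ b₁ b₂ ht
      have hE : ∫ s in (0)..t, (E₁ - E₂) s = (∫ s in (0)..t, E₁ s) - ∫ s in (0)..t, E₂ s :=
        intervalIntegral.integral_sub (Maxwell.intervalIntegrable_of_mem_Ioo h₁.integrable_E ht)
          (Maxwell.intervalIntegrable_of_mem_Ioo h₂.integrable_E ht)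
      have hB : ∫ s in (0)..t, (B₁ - B₂) s = (∫ s in (0)..t, B₁ s) - ∫ s in (0)..t, B₂ s :=
        intervalIntegral.integral_sub (Maxwell.intervalIntegrable_of_mem_Ioo h₁.integrable_B ht)
          (Maxwell.intervalIntegrable_of_mem_Ioo h₂.integrable_B ht)
      rw [hE, hB]
      simp only [Pi.sub_apply]
      set U := (∫ s in (0)..t, E₁ s) - ∫ s in (0)..t, E₂ s with hU
      set V := (∫ s in (0)..t, B₁ s) - ∫ s in (0)..t, B₂ s with hV
      -- The difference of the integrated Faraday laws is Green's formula for U with curl U = -(B₁ -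
      -- B₂), against every field of H(curl).
      have hmem : WithLp.toLp 2 (U, -(B₁ t - B₂ t)) ∈ Maxwell.Hcurl0 Ω :=
        Maxwell.mem_Hcurl0_of_forall_inner_eq fun φ => by
          change inner ℝ (-(B₁ t - B₂ t)) φ.1.fst = inner ℝ U φ.1.snd
          rw [inner_neg_left, inner_sub_left, b₁ φ, b₂ φ, hU, inner_sub_left]
          ring
      have e₁ := a₁ ⟨_, hmem⟩
      have e₂ := a₂ ⟨_, hmem⟩
      simp only [WithLp.toLp_fst, WithLp.toLp_snd] at e₁ e₂
      have hs := hσ.le_inner_mulCLM U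
      rw [zero_mul] at hs
      have h3 : inner ℝ (σ.mulCLM U) U = inner ℝ (σ.mulCLM (∫ s in (0)..t, E₁ s)) U
          - inner ℝ (σ.mulCLM (∫ s in (0)..t, E₂ s)) U := by
        rw [← inner_sub_left, ← map_sub]
      -- Symmetry of M turns the curl term of Ampère's law into the magnetic part of the energy
      -- derivative; only -(σU, U) remains.
      have h4 : inner ℝ (M (B₁ t - B₂ t)) V = - (inner ℝ (M (∫ s in (0)..t, B₁ s))
          (-(B₁ t - B₂ t)) - inner ℝ (M (∫ s in (0)..t, B₂ s)) (-(B₁ t - B₂ t))) := by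
        rw [← inner_sub_left, ← map_sub, ← hV, inner_neg_right, neg_neg, hMsymm,
          real_inner_comm]
      rw [map_sub, inner_sub_left]
      linarith)
  refine ⟨?_, ?_⟩
  · filter_upwards [hzero.1] with t ht
    exact sub_eq_zero.1 ht
  · filter_upwards [hzero.2] with t ht
    exact sub_eq_zero.1 ht
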